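/- Let $\mathcal{L} \subseteq \mathbb{R}^n$ be an $n$-dimensional lattice, i.e. a discrete subgroup of $\mathbb{R}^n$ whose linear span is $\mathbb{R}^n$. Let \[ \mathcal{V} = \{ z \in \mathbb{R}^n : \|z\|_2 \le \|z - w\|_2 \text{ for all } w \in \mathcal{L} \setminus \{0\} \} \] be its Voronoi cell, let $\partial\mathcal{V}$ be the topological boundary of $\mathcal{V}$, let $\mathcal{L} + \partial\mathcal{V} = \{ w + z : w \in \mathcal{L},\, z \in \partial\mathcal{V} \}$ be the boundary of the lattice tiling, and for $u \in \mathbb{R}^n$ let $\|u\|_{\mathcal{V}} = \inf\{ s \ge 0 : u \in s\mathcal{V} \}$ be the Voronoi norm. Let $Z$ be a random vector that is uniformly distributed on $\mathcal{V}$. Then for all $x, y \in \mathbb{R}^n$ the number $|(\mathcal{L} + \partial\mathcal{V}) \cap [x+Z, y+Z]| \in \{0, 1, 2, \dots, \infty\}$ of points in which the closed line segment $[x+Z, y+Z]$ meets the tiling boundary is a random variable (measurable up to a null set), and \[ \mathbb{E}\bigl[\, |(\mathcal{L} + \partial\mathcal{V}) \cap [x+Z, y+Z]| \,\bigr] \le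 \frac{n}{2}\, \|y - x\|_{\mathcal{V}} . \] -/

import Mathlib

open MeasureTheory
open scoped Pointwise

/-- The closed halfspace `H_y = {x : ‖x‖ ≤ ‖x - y‖}` of points at least as close to `0` as to `y`
(Euclidean norm). -/
def voronoiHalfspace {n : ℕ} (y : EuclideanSpace ℝ (Fin n)) : Set (EuclideanSpace ℝ (Fin n)) :=
  {x | ‖x‖ ≤ ‖x - y‖}

/-- The Voronoi cell of `L`: the intersection of the halfspaces `H_y` over the nonzero `y ∈ L`. -/
def voronoiCell {n : ℕ} (L : Submodule ℤ (EuclideanSpace ℝ (Fin n))) :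
    Set (EuclideanSpace ℝ (Fin n)) :=
  ⋂ y ∈ (L : Set (EuclideanSpace ℝ (Fin n))) \ {0}, voronoiHalfspace y

/-- The boundary `L + ∂V` of the lattice tiling: the Minkowski sum of the lattice and the
topological boundary of its Voronoi cell. -/
def tilingBoundary {n : ℕ} (L : Submodule ℤ (EuclideanSpace ℝ (Fin n))) :
    Set (EuclideanSpace ℝ (Fin n)) :=
  (L : Set (EuclideanSpace ℝ (Fin n))) + frontier (voronoiCell L)

/-- The number of points, in `{0, 1, 2, …, ∞}`, in which the closed segment `[a, b]` meets the
tiling boundary `L + ∂V`. -/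
noncomputable def crossings {n : ℕ} (L : Submodule ℤ (EuclideanSpace ℝ (Fin n)))
    (a b : EuclideanSpace ℝ (Fin n)) : ℕ∞ :=
  (tilingBoundary L ∩ segment ℝ a b).encard

/-- The Voronoi norm `‖x‖_V`: the gauge of the Voronoi cell. -/
noncomputable def voronoiNorm {n : ℕ} (L : Submodule ℤ (EuclideanSpace ℝ (Fin n)))
    (x : EuclideanSpace ℝ (Fin n)) : ℝ :=
  gauge (voronoiCell L) x

/-!
The bound rests on comparing volumes of the Voronoi cell `V` and of its translates and dilates; no
surface measure and no facet of `V` occurs.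

Put `u = y - x` and let `u ∈ s V`. Cut the segment `[x + Z, y + Z)` into `k` half-open pieces. The
number of pieces that meet the tiling boundary `T` never exceeds the number of crossings, and its
limit inferior is at least that number. This gives measurability
(`measurable_encard_hitTimes`) and, by Fatou's lemma, bounds the expected number of crossings by
the limit inferior of the sums of the `k` hitting probabilities
(`lintegral_encard_hitTimes_le`). The right end of the segment is almost surely not in `T`, because
`T` is a null set.

Each hitting probability can be computed with a piece that starts at `Z` itself: the event is
periodic under the lattice, and `V` and all its translates are fundamental domains
(`isAddFundamentalDomain_voronoiCell`, `measure_shift_mem_eq`). Since the interior of `V` does not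
meet `T`, a segment from an interior point `z` of `V` to `z + w`, where `w = u / k`, can hit `T`
before its end only if `z + w ∉ V`. So the probability is at most
`vol {z ∈ V | z + w ∉ V} / vol V`, which is `vol ((V + w) \ V) / vol V`.

The factor `1 / 2` comes from convexity (`two_mul_volume_add_notMem_le`). The sets `(V + w) \ V` and
`(V - w) \ V` have equal volume by the symmetry of `V`, and they are disjoint, because `z` is the
midpoint of `z - w` and `z + w`. Both lie in `(1 + s / k) V \ V`. Hence each probability is at most
`((1 + s / k) ^ n - 1) / 2`, and `k` times this tends to `n s / 2`. Letting `s` decrease to the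
gauge of `V` at `u` finishes the argument.
-/

open Filter Topology Set

/-! ### Counting points of a set of reals by subdivision -/

/-- Once the mesh `1 / k` is smaller than the gaps of a finite set of nonnegative reals, different
points of the set lie in different subintervals `[i / k, (i + 1) / k)`. -/
theorem eventually_injOn_floor_mul {F : Set ℝ} (hF : F.Finite) (h0 : ∀ t ∈ F, 0 ≤ t) :
    ∀ᶠ k : ℕ in atTop, InjOn (fun t : ℝ => ⌊(k : ℝ) * t⌋₊) F := by
  have key : ∀ a ∈ F, ∀ b ∈ F, ∀ᶠ k : ℕ in atTop,
      ⌊(k : ℝ) * a⌋₊ = ⌊(k : ℝ) * b⌋₊ → a = b := by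
    intro a ha b hb
    by_cases hab : a = b
    · simp [hab]
    have hpos : 0 < |a - b| := abs_pos.2 (sub_ne_zero.2 hab)
    filter_upwards [(tendsto_natCast_atTop_atTop (R := ℝ)).eventually_ge_atTop (1 / |a - b|)]
      with k hk heq
    exfalso
    rw [div_le_iff₀ hpos] at hk
    have a0 : 0 ≤ (k : ℝ) * a := mul_nonneg k.cast_nonneg (h0 a ha)
    have b0 : 0 ≤ (k : ℝ) * b := mul_nonneg k.cast_nonneg (h0 b hb)
    have a1 := Nat.floor_le a0
    have b1 := Nat.floor_le b0
    have a2 := Nat.lt_floor_add_one ((k : ℝ) * a)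
    have b2 := Nat.lt_floor_add_one ((k : ℝ) * b)
    rw [heq] at a1 a2
    have : |(k : ℝ) * a - k * b| < 1 := by rw [abs_lt]; constructor <;> linarith
    rw [← mul_sub, abs_mul, Nat.abs_cast] at this
    linarith
  have := (hF.eventually_all (l := atTop)).2 fun a ha =>
    (hF.eventually_all (l := atTop)).2 (key a ha)
  filter_upwards [this] with k hk a ha b hb h using hk a ha b hb h

/-- The number of subintervals of mesh `1 / k` that meet `S` is at least the number of points of `S`
in the limit. Neither `S` nor the limit inferior need be finite. -/
theorem encard_le_liminf_encard_image_floor_mul {S : Set ℝ} (h0 : ∀ t ∈ S, 0 ≤ t) :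
    (S.encard : ENNReal) ≤
      liminf (fun k : ℕ => (((fun t : ℝ => ⌊(k : ℝ) * t⌋₊) '' S).encard : ENNReal)) atTop := by
  have key : ∀ m : ℕ, (m : ℕ∞) ≤ S.encard → (m : ENNReal) ≤
      liminf (fun k : ℕ => (((fun t : ℝ => ⌊(k : ℝ) * t⌋₊) '' S).encard : ENNReal)) atTop := by
    intro m hm
    obtain ⟨F, hFS, hFm⟩ := Set.exists_subset_encard_eq hm
    have hF : F.Finite := by
      rw [← Set.encard_ne_top_iff, hFm]; exact ENat.natCast_ne_top m
    refine le_liminf_of_le (by isBoundedDefault) ?_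
    filter_upwards [eventually_injOn_floor_mul hF fun t ht => h0 t (hFS ht)] with k hk
    have : (m : ℕ∞) ≤ ((fun t : ℝ => ⌊(k : ℝ) * t⌋₊) '' S).encard := by
      rw [← hFm, ← hk.encard_image]
      exact Set.encard_le_encard (Set.image_mono hFS)
    simpa using ENat.toENNReal_le.2 this
  refine ENNReal.le_of_forall_nnreal_lt fun r hr => ?_
  induction hS : S.encard with
  | top =>
    obtain ⟨m, hm⟩ := exists_nat_ge r
    refine le_trans ?_ (key m (by simp [hS]))
    exact_mod_cast hm
  | coe m =>
    rw [hS] at hr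
    refine hr.le.trans ?_
    simpa using key m hS.ge

/-- The supremum form, over `k ≥ 1`, in which the cardinality is visibly measurable. -/
theorem encard_eq_iSup_encard_image_floor_mul {S : Set ℝ} (h0 : ∀ t ∈ S, 0 ≤ t) :
    (S.encard : ENNReal) =
      ⨆ k : ℕ, (((fun t : ℝ => ⌊((k + 1 : ℕ) : ℝ) * t⌋₊) '' S).encard : ENNReal) := by
  refine le_antisymm ?_ (iSup_le fun k => ENat.toENNReal_le.2 (Set.encard_image_le _ _))
  refine (encard_le_liminf_encard_image_floor_mul h0).trans ?_
  rw [← liminf_nat_add _ 1]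
  exact liminf_le_of_le (by isBoundedDefault) fun b hb => by
    obtain ⟨k, hk⟩ := hb.exists
    exact hk.trans (le_iSup (fun k : ℕ =>
      (((fun t : ℝ => ⌊((k + 1 : ℕ) : ℝ) * t⌋₊) '' S).encard : ENNReal)) k)

/-! ### Times at which a moving point hits a set -/

section Hitting

variable {E : Type*} [NormedAddCommGroup E] [NormedSpace ℝ E]

/-- The parameters `t ∈ [0, 1)` for which `z + t u` lies in `T`. The right end is left out so that
segments placed end to end do not share points. -/
def hitTimes (T : Set E) (u z : E) : Set ℝ := {t | t ∈ Ico (0 : ℝ) 1 ∧ z + t • u ∈ T}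

/-- The points `z` for which the half-open segment `[z, z + δ u)` meets `T`. -/
def hitSet (T : Set E) (u : E) (δ : ℝ) : Set E := {z | ∃ t ∈ Ico (0 : ℝ) δ, z + t • u ∈ T}

/-- `[0, δ)` is a countable union of compact intervals, so the hitting set of a closed set is a
countable union of sums of a closed and a compact set. -/
theorem measurableSet_hitSet_of_isClosed [MeasurableSpace E] [BorelSpace E] {C : Set E}
    (hC : IsClosed C) (u : E) (δ : ℝ) : MeasurableSet (hitSet C u δ) := by
  have : hitSet C u δ =
      ⋃ m : ℕ, C + (fun t : ℝ => -(t • u)) '' Icc (0 : ℝ) (δ - 1 / ((m : ℝ) + 1)) := by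
    ext z
    simp only [hitSet, mem_ofPred_eq, mem_iUnion, Set.mem_add, mem_image]
    constructor
    · rintro ⟨t, ⟨t0, t1⟩, ht⟩
      obtain ⟨m, hm⟩ := exists_nat_one_div_lt (sub_pos.2 t1)
      exact ⟨m, _, ht, _, ⟨t, ⟨t0, by linarith⟩, rfl⟩, by abel⟩
    · rintro ⟨m, c, hc, _, ⟨t, ⟨t0, t1⟩, rfl⟩, rfl⟩
      have : (0 : ℝ) < 1 / ((m : ℝ) + 1) := Nat.one_div_pos_of_nat
      exact ⟨t, ⟨t0, by linarith⟩, by simpa using hc⟩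
  rw [this]
  refine MeasurableSet.iUnion fun m => (hC.add_right_of_isCompact ?_).measurableSet
  exact isCompact_Icc.image (by fun_prop)

theorem hitSet_iUnion {ι : Type*} (T : ι → Set E) (u : E) (δ : ℝ) :
    hitSet (⋃ i, T i) u δ = ⋃ i, hitSet (T i) u δ := by
  ext z
  simp only [hitSet, mem_ofPred_eq, mem_iUnion]
  tauto

/-- The `i`-th of the `k` pieces of the segment `[z, z + u)` contains a hit exactly when the piece
starts at a point of `hitSet T u (1 / k)`. -/
theorem floor_mul_image_hitTimes (T : Set E) (u z : E) {k : ℕ} (hk : 0 < k) (i : ℕ) :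
    i ∈ (fun t : ℝ => ⌊(k : ℝ) * t⌋₊) '' hitTimes T u z ↔
      i < k ∧ z + ((i : ℝ) / k) • u ∈ hitSet T u (1 / k) := by
  have hk' : (0 : ℝ) < k := by exact_mod_cast hk
  constructor
  · rintro ⟨t, ⟨⟨t0, t1⟩, ht⟩, rfl⟩
    have h1 := Nat.floor_le (mul_nonneg hk'.le t0)
    have h2 := Nat.lt_floor_add_one ((k : ℝ) * t)
    dsimp only
    refine ⟨(Nat.floor_lt (mul_nonneg hk'.le t0)).2 (by nlinarith),
      t - (⌊(k : ℝ) * t⌋₊ : ℝ) / k, ⟨?_, ?_⟩, ?_⟩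
    · rw [sub_nonneg, div_le_iff₀ hk']; linarith
    · rw [sub_lt_iff_lt_add, ← add_div, lt_div_iff₀ hk']; linarith
    · rwa [add_assoc, ← add_smul, add_sub_cancel]
  · rintro ⟨hik, t, ⟨t0, t1⟩, ht⟩
    rw [lt_div_iff₀ hk'] at t1
    have hik' : (i : ℝ) + 1 ≤ k := by exact_mod_cast hik
    have hmul : (k : ℝ) * (i / k + t) = i + k * t := by field_simp
    have hkt : 0 ≤ (k : ℝ) * t := by positivity
    refine ⟨i / k + t, ⟨⟨by positivity, ?_⟩, ?_⟩, ?_⟩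
    · refine lt_of_mul_lt_mul_left (a := (k : ℝ)) ?_ hk'.le
      rw [hmul]; linarith
    · rwa [add_smul, ← add_assoc]
    · dsimp only
      rw [hmul, Nat.floor_eq_iff (by positivity)]
      constructor <;> linarith

theorem encard_floor_mul_image_hitTimes (T : Set E) (u z : E) {k : ℕ} (hk : 0 < k) :
    ((((fun t : ℝ => ⌊(k : ℝ) * t⌋₊) '' hitTimes T u z).encard : ℕ∞) : ENNReal) =
      ∑ i ∈ Finset.range k, (hitSet T u (1 / k)).indicator 1 (z + ((i : ℝ) / k) • u) := by
  classical
  have : (fun t : ℝ => ⌊(k : ℝ) * t⌋₊) '' hitTimes T u z =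
      ((Finset.range k).filter fun i => z + ((i : ℝ) / k) • u ∈ hitSet T u (1 / k) : Finset ℕ) := by
    ext i
    rw [floor_mul_image_hitTimes T u z hk]
    simp
  rw [this, Set.encard_coe_eq_coe_finsetCard]
  simp [Set.indicator_apply]

/-- The segment `[z, z + u]` meets `T` in as many points as there are hitting times, provided that
its right end is not in `T`. -/
theorem encard_inter_segment (T : Set E) {u z : E} (hu : u ≠ 0) (h : z + u ∉ T) :
    (T ∩ segment ℝ z (z + u)).encard = (hitTimes T u z).encard := by
  have hinj : Function.Injective fun t : ℝ => z + t • u :=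
    (add_right_injective z).comp (smul_left_injective ℝ hu)
  rw [← hinj.injOn.encard_image (s := hitTimes T u z)]
  congr 1
  ext p
  rw [segment_eq_image']
  simp only [add_sub_cancel_left, mem_inter_iff, mem_image, mem_Icc, hitTimes, mem_ofPred_eq,
    mem_Ico]
  constructor
  · rintro ⟨hp, t, ⟨t0, t1⟩, rfl⟩
    refine ⟨t, ⟨⟨t0, t1.lt_of_ne ?_⟩, hp⟩, rfl⟩
    rintro rfl
    exact h (by simpa using hp)
  · rintro ⟨t, ⟨⟨t0, t1⟩, hp⟩, rfl⟩
    exact ⟨hp, t, ⟨t0, t1.le⟩, rfl⟩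

theorem measurable_encard_hitTimes [MeasurableSpace E] [BorelSpace E] {T : Set E} {u : E}
    (hT : ∀ δ, MeasurableSet (hitSet T u δ)) :
    Measurable fun z => ((hitTimes T u z).encard : ENNReal) := by
  simp_rw [fun z => encard_eq_iSup_encard_image_floor_mul (S := hitTimes T u z)
    fun t ht => ht.1.1, encard_floor_mul_image_hitTimes T u _ (Nat.succ_pos _)]
  refine .iSup fun k => Finset.measurable_fun_sum _ fun i _ => ?_
  exact (measurable_one.indicator (hT _)).comp (continuous_add_const _).measurable

end Hitting

/-! ### Volume swept by a symmetric convex body -/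

/-- Moving a symmetric convex set `V` by `w ∈ ε V` costs at most half of the volume of the shell
`(1 + ε) V \ V`: the sets `(V + w) \ V` and `(V - w) \ V` lie in the shell, have the same volume,
and are disjoint, because a point `z` with `z + w ∈ V` and `z - w ∈ V` is a midpoint of points
of `V`. -/
theorem two_mul_volume_add_notMem_le {E : Type*} [NormedAddCommGroup E] [NormedSpace ℝ E]
    [FiniteDimensional ℝ E] [MeasurableSpace E] [BorelSpace E] (μ : Measure E)
    [μ.IsAddHaarMeasure] {V : Set E} (hV : Convex ℝ V) (hVm : MeasurableSet V)
    (hsymm : ∀ v ∈ V, -v ∈ V) (h0 : (0 : E) ∈ V) {ε : ℝ} (hε : 0 ≤ ε) {w : E} (hw : w ∈ ε • V) :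
    2 * μ {z | z ∈ V ∧ z + w ∉ V} + μ V ≤
      ENNReal.ofReal ((1 + ε) ^ Module.finrank ℝ E) * μ V := by
  obtain ⟨v, hv, rfl⟩ := hw
  set w : E := ε • v with hw
  set D : Set E := {z | z ∈ V ∧ z + w ∉ V} with hD
  have hDm : MeasurableSet D := hVm.inter
    ((continuous_add_const w).measurable hVm).compl
  -- `A` and `B` are the sets `(V - w) \ V` and `(V + w) \ V`.
  set A : Set E := (fun z => z + w) ⁻¹' (Neg.neg ⁻¹' D) with hA
  set B : Set E := (fun z => z + -w) ⁻¹' D with hB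
  have hAm : MeasurableSet A := (continuous_add_const w).measurable (measurable_neg hDm)
  have hBm : MeasurableSet B := (continuous_add_const (-w)).measurable hDm
  have hμA : μ A = μ D := by
    rw [hA, measure_preimage_add_right, Measure.measure_preimage_neg]
  have hμB : μ B = μ D := by rw [hB, measure_preimage_add_right]
  have memA : ∀ z, z ∈ A → z + w ∈ V ∧ z ∉ V := by
    rintro z ⟨h1, h2⟩
    refine ⟨by simpa using hsymm _ h1, fun hz => h2 ?_⟩
    simpa using hsymm _ hz
  have memB : ∀ z, z ∈ B → z - w ∈ V ∧ z ∉ V := by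
    rintro z ⟨h1, h2⟩
    exact ⟨by simpa [sub_eq_add_neg] using h1, by simpa using h2⟩
  have hAB : Disjoint A B := by
    rw [Set.disjoint_left]
    intro z hzA hzB
    obtain ⟨h1, h2⟩ := memA z hzA
    obtain ⟨h3, -⟩ := memB z hzB
    apply h2
    have := hV h1 h3 (by norm_num : (0 : ℝ) ≤ 1 / 2) (by norm_num : (0 : ℝ) ≤ 1 / 2) (by norm_num)
    convert this using 1
    module
  have hABV : Disjoint (A ∪ B) V := by
    rw [Set.disjoint_left]
    rintro z (hz | hz)
    · exact (memA z hz).2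
    · exact (memB z hz).2
  have hadd : ∀ p ∈ V, ∀ q ∈ V, p + ε • q ∈ (1 + ε) • V := by
    intro p hp q hq
    rw [hV.add_smul zero_le_one hε, one_smul]
    exact Set.add_mem_add hp (Set.smul_mem_smul_set hq)
  have hsub : A ∪ B ∪ V ⊆ (1 + ε) • V := by
    rintro z ((hz | hz) | hz)
    · simpa [hw] using hadd _ (memA z hz).1 _ (hsymm v hv)
    · simpa [hw] using hadd _ (memB z hz).1 v hv
    · simpa using hadd z hz 0 h0
  calc 2 * μ D + μ V = μ (A ∪ B ∪ V) := by
        rw [measure_union hABV hVm, measure_union hAB hBm, hμA, hμB, two_mul]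
    _ ≤ μ ((1 + ε) • V) := measure_mono hsub
    _ = ENNReal.ofReal ((1 + ε) ^ Module.finrank ℝ E) * μ V := by
        rw [Measure.addHaar_smul, abs_of_nonneg (by positivity)]

theorem tendsto_mul_one_add_div_pow_sub_one (n : ℕ) (s : ℝ) :
    Tendsto (fun k : ℕ => (k : ℝ) * (((1 + s / k) ^ n - 1) / 2)) atTop (𝓝 (n / 2 * s)) := by
  have hd : HasDerivAt (fun x : ℝ => (1 + s * x) ^ n) (n * s) 0 := by
    have := (((hasDerivAt_id (0 : ℝ)).const_mul s).const_add 1).fun_pow n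
    simpa using this
  have ht : Tendsto (fun k : ℕ => ((k : ℝ))⁻¹) atTop (𝓝[≠] 0) := by
    rw [tendsto_nhdsWithin_iff]
    refine ⟨tendsto_inv_atTop_nhds_zero_nat, ?_⟩
    filter_upwards [eventually_gt_atTop 0] with k hk
    have : (k : ℝ) ≠ 0 := by exact_mod_cast hk.ne'
    simpa using this
  have := ((hasDerivAt_iff_tendsto_slope.1 hd).comp ht).div_const 2
  convert this using 2 with k
  · simp [slope_def_field, div_eq_mul_inv]
    ring
  · ring

/-! ### The Voronoi cell of a lattice -/

section Voronoi

variable {n : ℕ} (L : Submodule ℤ (EuclideanSpace ℝ (Fin n)))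

theorem mem_voronoiHalfspace_iff {y z : EuclideanSpace ℝ (Fin n)} :
    z ∈ voronoiHalfspace y ↔ 2 * inner ℝ z y ≤ ‖y‖ ^ 2 := by
  have : z ∈ voronoiHalfspace y ↔ ‖z‖ ^ 2 ≤ ‖z - y‖ ^ 2 :=
    (sq_le_sq₀ (norm_nonneg _) (norm_nonneg _)).symm
  rw [this, norm_sub_sq_real]
  constructor <;> intro h <;> linarith

theorem mem_voronoiCell_iff {z : EuclideanSpace ℝ (Fin n)} :
    z ∈ voronoiCell L ↔ ∀ y ∈ L, ‖z‖ ≤ ‖z - y‖ := by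
  simp only [voronoiCell, voronoiHalfspace, mem_iInter, Set.mem_sdiff, SetLike.mem_coe,
    mem_singleton_iff, mem_ofPred_eq]
  refine ⟨fun h y hy => ?_, fun h y hy => h y hy.1⟩
  by_cases hy0 : y = 0
  · simp [hy0]
  · exact h y ⟨hy, hy0⟩

theorem mem_voronoiCell_iff_inner {z : EuclideanSpace ℝ (Fin n)} :
    z ∈ voronoiCell L ↔ ∀ y ∈ L, 2 * inner ℝ z y ≤ ‖y‖ ^ 2 := by
  rw [mem_voronoiCell_iff]
  exact forall₂_congr fun y _ => mem_voronoiHalfspace_iff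

theorem isClosed_voronoiCell : IsClosed (voronoiCell L) :=
  isClosed_biInter fun _ _ => isClosed_le continuous_norm (by fun_prop)

theorem convex_voronoiCell : Convex ℝ (voronoiCell L) := by
  refine convex_iInter₂ fun y _ => ?_
  have : voronoiHalfspace y =
      {z | (2 : ℝ) * inner ℝ y z ≤ ‖y‖ ^ 2} := by
    ext z
    rw [mem_voronoiHalfspace_iff, real_inner_comm]
    rfl
  rw [this]
  exact convex_halfSpace_le ((2 : ℝ) • innerₗ _ y).isLinear _

theorem neg_mem_voronoiCell {z : EuclideanSpace ℝ (Fin n)} (hz : z ∈ voronoiCell L) :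
    -z ∈ voronoiCell L := by
  rw [mem_voronoiCell_iff_inner] at hz ⊢
  intro y hy
  simpa using hz (-y) (L.neg_mem hy)

theorem zero_mem_voronoiCell : (0 : EuclideanSpace ℝ (Fin n)) ∈ voronoiCell L := by
  simp [mem_voronoiCell_iff]

theorem voronoiCell_mem_nhds_zero [DiscreteTopology L] : voronoiCell L ∈ 𝓝 0 := by
  obtain ⟨r, hr, h⟩ := Metric.isOpen_singleton_iff.1 (isOpen_discrete ({0} : Set L))
  refine Filter.mem_of_superset (Metric.ball_mem_nhds 0 (half_pos hr)) fun z hz => ?_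
  rw [mem_ball_zero_iff] at hz
  rw [mem_voronoiCell_iff]
  intro y hy
  by_cases hy0 : y = 0
  · simp [hy0]
  have hry : r ≤ ‖y‖ := by
    by_contra hlt
    push Not at hlt
    have := h ⟨y, hy⟩ (by simpa [Subtype.dist_eq] using hlt)
    exact hy0 (congrArg Subtype.val this)
  have := norm_sub_norm_le y z
  rw [norm_sub_rev] at this
  linarith

/-- An interior point of the Voronoi cell lies on none of the bisecting hyperplanes. -/
theorem two_mul_inner_lt_of_mem_interior_voronoiCell {z g : EuclideanSpace ℝ (Fin n)}
    (hz : z ∈ interior (voronoiCell L)) (hg : g ∈ L) (hg0 : g ≠ 0) :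
    2 * inner ℝ z g < ‖g‖ ^ 2 := by
  have hcont : Tendsto (fun δ : ℝ => z + δ • g) (𝓝[>] 0) (𝓝 z) := by
    have : Continuous fun δ : ℝ => z + δ • g := by fun_prop
    simpa using (this.tendsto 0).mono_left nhdsWithin_le_nhds
  obtain ⟨δ, hδ, hδ0⟩ := ((hcont.eventually_mem (mem_interior_iff_mem_nhds.1 hz)).and
    self_mem_nhdsWithin).exists
  have h1 := (mem_voronoiCell_iff_inner L).1 hδ g hg
  rw [inner_add_left, real_inner_smul_left, real_inner_self_eq_norm_sq] at h1
  have : 0 < δ * ‖g‖ ^ 2 := mul_pos hδ0 (by positivity)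
  linarith

theorem disjoint_interior_voronoiCell_tilingBoundary :
    Disjoint (interior (voronoiCell L)) (tilingBoundary L) := by
  rw [Set.disjoint_left]
  rintro _ hz ⟨g, hg, f, hf, rfl⟩
  dsimp only at hz
  have hfV : f ∈ voronoiCell L := (isClosed_voronoiCell L).frontier_subset hf
  by_cases hg0 : g = 0
  · rw [hg0, zero_add] at hz
    exact hf.2 hz
  have h1 := two_mul_inner_lt_of_mem_interior_voronoiCell L hz hg hg0
  have h2 := (mem_voronoiCell_iff_inner L).1 hfV (-g) (L.neg_mem hg)
  rw [inner_add_left, real_inner_self_eq_norm_sq] at h1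
  rw [inner_neg_right, norm_neg] at h2
  linarith

theorem tilingBoundary_eq_iUnion :
    tilingBoundary L = ⋃ g : L, (fun z => -(g : EuclideanSpace ℝ (Fin n)) + z) ⁻¹'
      frontier (voronoiCell L) := by
  ext z
  simp only [tilingBoundary, mem_iUnion, Set.mem_add, mem_preimage, SetLike.mem_coe]
  constructor
  · rintro ⟨g, hg, f, hf, rfl⟩
    exact ⟨⟨g, hg⟩, by simpa using hf⟩
  · rintro ⟨g, hg⟩
    exact ⟨g, g.2, _, hg, by simp⟩

theorem vadd_mem_tilingBoundary_iff {g z : EuclideanSpace ℝ (Fin n)} (hg : g ∈ L) :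
    g + z ∈ tilingBoundary L ↔ z ∈ tilingBoundary L := by
  have key : ∀ g ∈ L, ∀ z ∈ tilingBoundary L, g + z ∈ tilingBoundary L := by
    rintro g hg _ ⟨h, hh, f, hf, rfl⟩
    exact ⟨g + h, L.add_mem hg hh, f, hf, add_assoc _ _ _⟩
  refine ⟨fun h => ?_, key g hg z⟩
  simpa using key (-g) (L.neg_mem hg) _ h

theorem vadd_mem_hitSet_tilingBoundary_iff {g z : EuclideanSpace ℝ (Fin n)} (hg : g ∈ L)
    (u : EuclideanSpace ℝ (Fin n)) (δ : ℝ) :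
    g + z ∈ hitSet (tilingBoundary L) u δ ↔ z ∈ hitSet (tilingBoundary L) u δ := by
  simp only [hitSet, mem_ofPred_eq, add_assoc, vadd_mem_tilingBoundary_iff L hg]

/-- A segment that starts in the interior of the Voronoi cell and meets the tiling boundary before
its right end must leave the cell. -/
theorem add_smul_notMem_voronoiCell {z u : EuclideanSpace ℝ (Fin n)} {δ : ℝ}
    (hz : z ∈ voronoiCell L) (hzT : z ∉ frontier (voronoiCell L))
    (hhit : z ∈ hitSet (tilingBoundary L) u δ) : z + δ • u ∉ voronoiCell L := by
  obtain ⟨t, ⟨t0, t1⟩, ht⟩ := hhit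
  intro hend
  have hint : z ∈ interior (voronoiCell L) := by
    by_contra h
    exact hzT ⟨subset_closure hz, h⟩
  have hδ : 0 < δ := t0.trans_lt t1
  refine Set.disjoint_left.1 (disjoint_interior_voronoiCell_tilingBoundary L) ?_ ht
  have := (convex_voronoiCell L).combo_interior_self_mem_interior hint hend
    (a := 1 - t / δ) (b := t / δ) (by rw [sub_pos, div_lt_one hδ]; exact t1) (by positivity)
    (by ring)
  convert this using 1
  rw [smul_add, smul_smul, div_mul_cancel₀ _ hδ.ne']
  module

theorem volume_voronoiCell_ne_zero [DiscreteTopology L] : volume (voronoiCell L) ≠ 0 :=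
  (Measure.measure_pos_of_mem_nhds volume (voronoiCell_mem_nhds_zero L)).ne'

variable [DiscreteTopology L] [IsZLattice ℝ L]

theorem volume_tilingBoundary : volume (tilingBoundary L) = 0 := by
  rw [tilingBoundary_eq_iUnion, measure_iUnion_null_iff]
  intro g
  rw [measure_preimage_add]
  exact (convex_voronoiCell L).addHaar_frontier volume

theorem measurableSet_hitSet_tilingBoundary (u : EuclideanSpace ℝ (Fin n)) (δ : ℝ) :
    MeasurableSet (hitSet (tilingBoundary L) u δ) := by
  rw [tilingBoundary_eq_iUnion, hitSet_iUnion]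
  exact .iUnion fun g => measurableSet_hitSet_of_isClosed
    (isClosed_frontier.preimage (by fun_prop)) u δ

/-- The translates of the Voronoi cell tile the space: every point has a nearest lattice point, and
two translates overlap in a part of the tiling boundary. -/
theorem isAddFundamentalDomain_voronoiCell :
    IsAddFundamentalDomain L.toAddSubgroup (voronoiCell L) volume := by
  have : DiscreteTopology L.toAddSubgroup := inferInstanceAs (DiscreteTopology L)
  have : Countable L.toAddSubgroup := inferInstanceAs (Countable L)
  refine IsAddFundamentalDomain.mk'' (isClosed_voronoiCell L).measurableSet.nullMeasurableSet
    (Eventually.of_forall fun z => ?_) (fun g hg => ?_)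
    fun g => (measurePreserving_vadd g volume).quasiMeasurePreserving
  · have hclosed : IsClosed (L.toAddSubgroup : Set (EuclideanSpace ℝ (Fin n))) :=
      AddSubgroup.isClosed_of_discrete
    obtain ⟨w, hw, hzw⟩ := hclosed.exists_infDist_eq_dist ⟨0, zero_mem _⟩ z
    refine ⟨⟨-w, neg_mem hw⟩, (mem_voronoiCell_iff L).2 fun y hy => ?_⟩
    have := Metric.infDist_le_dist_of_mem (x := z) (add_mem hw hy : w + y ∈ L.toAddSubgroup)
    rw [hzw, dist_eq_norm, dist_eq_norm] at this
    change ‖-w + z‖ ≤ ‖-w + z - y‖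
    rwa [neg_add_eq_sub, sub_sub]
  · refine measure_mono_null ?_ (volume_tilingBoundary L)
    rintro _ ⟨⟨f, hf, rfl⟩, hz⟩
    change (g : EuclideanSpace ℝ (Fin n)) + f ∈ voronoiCell L at hz
    change (g : EuclideanSpace ℝ (Fin n)) + f ∈ tilingBoundary L
    have hg0 : (g : EuclideanSpace ℝ (Fin n)) ≠ 0 := fun h => hg (Subtype.ext h)
    refine ⟨g, g.2, f, ⟨subset_closure hf, fun hfi => ?_⟩, rfl⟩
    have h1 := two_mul_inner_lt_of_mem_interior_voronoiCell L hfi (L.neg_mem g.2)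
      (neg_ne_zero.2 hg0)
    have h2 := (mem_voronoiCell_iff_inner L).1 hz g g.2
    rw [inner_neg_right, norm_neg] at h1
    rw [inner_add_left, real_inner_self_eq_norm_sq] at h2
    linarith

theorem volume_voronoiCell_ne_top : volume (voronoiCell L) ≠ ⊤ := by
  have : Countable L.toAddSubgroup := inferInstanceAs (Countable L)
  let b := Module.Free.chooseBasis ℤ L
  have hb : IsAddFundamentalDomain L.toAddSubgroup
      (ZSpan.fundamentalDomain (b.ofZLatticeBasis ℝ)) volume :=
    ZLattice.isAddFundamentalDomain b volume
  rw [(isAddFundamentalDomain_voronoiCell L).measure_eq hb]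
  exact (ZSpan.fundamentalDomain_isBounded _).measure_lt_top.ne

/-! ### The expected number of crossings -/

variable {Ω : Type*} [MeasurableSpace Ω] {P : Measure Ω} {Z : Ω → EuclideanSpace ℝ (Fin n)}

/-- For a lattice-periodic event, the shift of a uniform point of the Voronoi cell is again
uniform. -/
theorem measure_shift_mem_eq (hZ : pdf.IsUniform Z (voronoiCell L) P volume)
    {A : Set (EuclideanSpace ℝ (Fin n))} (hA : MeasurableSet A)
    (hper : ∀ g ∈ L, ∀ z, g + z ∈ A ↔ z ∈ A) (a : EuclideanSpace ℝ (Fin n)) :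
    P {ω | a + Z ω ∈ A} = volume (voronoiCell L ∩ A) / volume (voronoiCell L) := by
  have : Countable L.toAddSubgroup := inferInstanceAs (Countable L)
  have hpre : MeasurableSet ((fun z => a + z) ⁻¹' A) := (continuous_const_add a).measurable hA
  have h1 := hZ.measure_preimage (volume_voronoiCell_ne_zero L) (volume_voronoiCell_ne_top L) hpre
  change P (Z ⁻¹' ((fun z => a + z) ⁻¹' A)) = _
  rw [h1]
  congr 1
  have hF := isAddFundamentalDomain_voronoiCell L
  rw [inter_comm _ A, ← (hF.vadd_of_comm a).measure_set_eq hF hA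
    fun g => Set.ext fun z => hper g g.2 z,
    ← measure_preimage_add volume a (A ∩ (a +ᵥ voronoiCell L)), inter_comm]
  congr 1
  ext z
  simp [Set.mem_vadd_set_iff_neg_vadd_mem]

/-- The probability that a short segment `[a + Z, a + Z + δ u)` meets the tiling boundary. -/
theorem measure_shift_mem_hitSet_le (hZ : pdf.IsUniform Z (voronoiCell L) P volume)
    (a : EuclideanSpace ℝ (Fin n)) {u : EuclideanSpace ℝ (Fin n)} {s δ : ℝ} (hs : 0 ≤ s)
    (hδ : 0 ≤ δ) (hu : u ∈ s • voronoiCell L) :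
    P {ω | a + Z ω ∈ hitSet (tilingBoundary L) u δ} ≤
      ENNReal.ofReal (((1 + s * δ) ^ n - 1) / 2) := by
  rw [measure_shift_mem_eq L hZ (measurableSet_hitSet_tilingBoundary L u δ)
    (fun g hg z => vadd_mem_hitSet_tilingBoundary_iff L hg u δ)]
  have hV0 := volume_voronoiCell_ne_zero L
  have hVt := volume_voronoiCell_ne_top L
  have hw : δ • u ∈ (s * δ) • voronoiCell L := by
    rw [mul_comm, mul_smul]
    exact smul_mem_smul_set hu
  have h2 := two_mul_volume_add_notMem_le volume (convex_voronoiCell L)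
    (isClosed_voronoiCell L).measurableSet (fun v hv => neg_mem_voronoiCell L hv)
    (zero_mem_voronoiCell L) (mul_nonneg hs hδ) hw
  rw [finrank_euclideanSpace_fin] at h2
  have h1 : volume (voronoiCell L ∩ hitSet (tilingBoundary L) u δ) ≤
      volume {z | z ∈ voronoiCell L ∧ z + δ • u ∉ voronoiCell L} := by
    refine measure_mono_ae ?_
    filter_upwards [measure_eq_zero_iff_ae_notMem.1
      ((convex_voronoiCell L).addHaar_frontier volume)] with z hzT hz
    exact ⟨hz.1, add_smul_notMem_voronoiCell L hz.1 hzT hz.2⟩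
  refine (ENNReal.div_le_div_right h1 _).trans ?_
  rw [ENNReal.div_le_iff hV0 hVt]
  have hfin : volume {z | z ∈ voronoiCell L ∧ z + δ • u ∉ voronoiCell L} ≠ ⊤ :=
    measure_ne_top_of_subset (fun z hz => hz.1) hVt
  set D := volume {z | z ∈ voronoiCell L ∧ z + δ • u ∉ voronoiCell L}
  set V := volume (voronoiCell L)
  have hp : 1 ≤ (1 + s * δ) ^ n := one_le_pow₀ (by nlinarith)
  rw [← ENNReal.ofReal_toReal hfin, ← ENNReal.ofReal_toReal hVt] at h2 ⊢
  rw [← ENNReal.ofReal_mul (by linarith)]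
  refine ENNReal.ofReal_le_ofReal ?_
  rw [← ENNReal.ofReal_mul (by positivity), ← ENNReal.ofReal_ofNat,
    ← ENNReal.ofReal_mul (by norm_num), ← ENNReal.ofReal_add (by positivity) (by positivity),
    ENNReal.ofReal_le_ofReal_iff (by positivity)] at h2
  linarith

/-- The expected number of hitting times, bounded through the subdivision into `k` pieces, each of
which is hit with probability at most `((1 + s / k) ^ n - 1) / 2`, and Fatou's lemma. -/
theorem lintegral_encard_hitTimes_le (hZ : pdf.IsUniform Z (voronoiCell L) P volume)
    (x : EuclideanSpace ℝ (Fin n)) {u : EuclideanSpace ℝ (Fin n)} {s : ℝ} (hs : 0 ≤ s)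
    (hu : u ∈ s • voronoiCell L) :
    ∫⁻ ω, ((hitTimes (tilingBoundary L) u (x + Z ω)).encard : ENNReal) ∂P ≤
      ENNReal.ofReal (n / 2 * s) := by
  set T := tilingBoundary L
  have hZm : AEMeasurable Z P :=
    hZ.aemeasurable (volume_voronoiCell_ne_zero L) (volume_voronoiCell_ne_top L)
  let N : ℕ → Ω → ENNReal := fun k ω =>
    ∑ i ∈ Finset.range k, (hitSet T u (1 / k)).indicator 1 (x + Z ω + ((i : ℝ) / k) • u)
  have hterm : ∀ k i : ℕ, AEMeasurable
      (fun ω => (hitSet T u (1 / k)).indicator (1 : EuclideanSpace ℝ (Fin n) → ENNReal)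
        (x + Z ω + ((i : ℝ) / k) • u)) P :=
    fun k i => (measurable_one.indicator
      (measurableSet_hitSet_tilingBoundary L u (1 / k))).comp_aemeasurable
      ((hZm.const_add x).add_const _)
  have hle : ∀ ω, ((hitTimes T u (x + Z ω)).encard : ENNReal) ≤
      liminf (fun k => N k ω) atTop := fun ω => by
    refine (encard_le_liminf_encard_image_floor_mul fun t ht => ht.1.1).trans_eq ?_
    refine liminf_congr ?_
    filter_upwards [eventually_gt_atTop 0] with k hk
    exact encard_floor_mul_image_hitTimes T u _ hk
  have hN : ∀ k, ∫⁻ ω, N k ω ∂P ≤ ENNReal.ofReal (k * (((1 + s / k) ^ n - 1) / 2)) := fun k => by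
    rw [lintegral_finsetSum' _ fun i _ => hterm k i, ENNReal.ofReal_mul k.cast_nonneg,
      ENNReal.ofReal_natCast]
    refine (Finset.sum_le_card_nsmul _ _
      (ENNReal.ofReal (((1 + s / k) ^ n - 1) / 2)) fun i _ => ?_).trans_eq (by simp)
    have hset : NullMeasurableSet
        {ω | x + ((i : ℝ) / k) • u + Z ω ∈ hitSet T u (1 / k)} P :=
      (hZm.const_add _).nullMeasurable (measurableSet_hitSet_tilingBoundary L u (1 / k))
    have heq : (fun ω => (hitSet T u (1 / k)).indicator (1 : EuclideanSpace ℝ (Fin n) → ENNReal)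
        (x + Z ω + ((i : ℝ) / k) • u)) =
        {ω | x + ((i : ℝ) / k) • u + Z ω ∈ hitSet T u (1 / k)}.indicator 1 := by
      ext ω
      rw [add_right_comm]
      rfl
    rw [heq, lintegral_indicator_one₀ hset, div_eq_mul_one_div s]
    exact measure_shift_mem_hitSet_le L hZ _ hs (by positivity) hu
  calc ∫⁻ ω, ((hitTimes T u (x + Z ω)).encard : ENNReal) ∂P
      ≤ ∫⁻ ω, liminf (fun k => N k ω) atTop ∂P := lintegral_mono hle
    _ ≤ liminf (fun k => ∫⁻ ω, N k ω ∂P) atTop :=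
        lintegral_liminf_le' fun k => Finset.aemeasurable_fun_sum _ fun i _ => hterm k i
    _ ≤ liminf (fun k : ℕ => ENNReal.ofReal (k * (((1 + s / k) ^ n - 1) / 2))) atTop :=
        liminf_le_liminf (Eventually.of_forall hN)
    _ = ENNReal.ofReal (n / 2 * s) :=
        (ENNReal.tendsto_ofReal (tendsto_mul_one_add_div_pow_sub_one n s)).liminf_eq

/-- Almost surely the right end of the segment is not in the tiling boundary, so that the
half-open count agrees with the number of crossings. When `x = y` both are zero. -/
theorem crossings_ae_eq (hZ : pdf.IsUniform Z (voronoiCell L) P volume)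
    (x y : EuclideanSpace ℝ (Fin n)) :
    (fun ω => (crossings L (x + Z ω) (y + Z ω) : ENNReal)) =ᵐ[P]
      fun ω => ((hitTimes (tilingBoundary L) (y - x) (x + Z ω)).encard : ENNReal) := by
  have hZm : AEMeasurable Z P :=
    hZ.aemeasurable (volume_voronoiCell_ne_zero L) (volume_voronoiCell_ne_top L)
  have hnull : ∀ᵐ z ∂(volume : Measure (EuclideanSpace ℝ (Fin n))), y + z ∉ tilingBoundary L := by
    have : volume ((fun z => y + z) ⁻¹' tilingBoundary L) = 0 := by
      rw [measure_preimage_add, volume_tilingBoundary]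
    exact measure_eq_zero_iff_ae_notMem.1 this
  filter_upwards [ae_of_ae_map hZm (hZ.absolutelyContinuous.ae_le hnull)] with ω hω
  have hy : y + Z ω = x + Z ω + (y - x) := by abel
  congr 1
  by_cases hu : y - x = 0
  · rw [sub_eq_zero] at hu
    subst hu
    simp only [crossings, hitTimes, sub_self, smul_zero, add_zero, segment_same, hω, and_false]
    simp [hω]
  · rw [crossings, hy, encard_inter_segment _ hu (hy ▸ hω)]

end Voronoi

theorem mainTheorem3 {n : ℕ} (L : Submodule ℤ (EuclideanSpace ℝ (Fin n)))
    [DiscreteTopology L] [IsZLattice ℝ L]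
    {Ω : Type*} [MeasurableSpace Ω] (P : Measure Ω) [IsProbabilityMeasure P]
    (Z : Ω → EuclideanSpace ℝ (Fin n)) (hZ : pdf.IsUniform Z (voronoiCell L) P volume)
    (x y : EuclideanSpace ℝ (Fin n)) :
    AEMeasurable (fun ω => (crossings L (x + Z ω) (y + Z ω) : ENNReal)) P ∧
      ∫⁻ ω, (crossings L (x + Z ω) (y + Z ω) : ENNReal) ∂P ≤
        ENNReal.ofReal ((n : ℝ) / 2 * voronoiNorm L (y - x)) := by
  have hZm : AEMeasurable Z P :=
    hZ.aemeasurable (volume_voronoiCell_ne_zero L) (volume_voronoiCell_ne_top L)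
  have hae := crossings_ae_eq L hZ x y
  constructor
  · refine AEMeasurable.congr ?_ hae.symm
    exact (measurable_encard_hitTimes
      (measurableSet_hitSet_tilingBoundary L (y - x))).comp_aemeasurable (hZm.const_add x)
  · rw [lintegral_congr_ae hae]
    -- The bound holds for every `s` above the gauge; let `s` decrease to the gauge.
    have hlim : Tendsto (fun s : ℝ => ENNReal.ofReal ((n : ℝ) / 2 * s))
        (𝓝[>] (voronoiNorm L (y - x)))
        (𝓝 (ENNReal.ofReal ((n : ℝ) / 2 * voronoiNorm L (y - x)))) := by
      refine ENNReal.tendsto_ofReal (Tendsto.const_mul _ ?_)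
      exact tendsto_id.mono_left nhdsWithin_le_nhds
    refine ge_of_tendsto hlim ?_
    filter_upwards [self_mem_nhdsWithin] with s hs
    obtain ⟨r, hr0, hrs, hur⟩ := exists_lt_of_gauge_lt
      (absorbent_nhds_zero (voronoiCell_mem_nhds_zero L)) hs
    refine (lintegral_encard_hitTimes_le L hZ x hr0.le hur).trans (ENNReal.ofReal_le_ofReal ?_)
    gcongr
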